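/- A selfish ring routing instance consists of a ring (a cycle with $n \ge 2$ nodes and $n$ links, where for $n = 2$ the two links are parallel), nonnegative real constants $a_e, b_e$ for every link $e$, and finitely many agents $i = 1, \dots, k$, each with a source node $s_i$ and a destination node $t_i \neq s_i$; the pairs $(s_i,t_i)$ are arbitrary. A feasible routing $\pi = (P_1, \dots, P_k)$ assigns to each agent $i$ one of the two paths $P_i$ on the ring between $s_i$ and $t_i$. For a set $P$ of links let $$\ell(P,\pi) = \sum_{e \in P} \bigl(a_e\,|\{i : e \in P_i\}| + b_e\bigr),$$ so that $\ell(P_i, \pi)$ is the latency of agent $i$, and let $M(\pi) = \max_i \ell(P_i,\pi)$ (with $M(\pi) = 0$ if there are no agents). The routing $\pi$ is a Nash equilibrium if no agent can reduce its latency by switching to its other path while all other agents keep their paths, and it is optimal if it minimizes $M$ over all feasible routings. The price of anarchy is the supremum of $M(\pi^N)/M(\pi^*)$ over all instances, all Nash equilibria $\pi^N$ and all optimal routings $\pi^*$ (with the conventions $0/0 = 0$ and $c/0 = \infty$ for $c > 0$). **Theorem.** The price of anarchy for selfish ring routing with linear latencies is exactly $2$. Moreover, the supremum is attained: there is an instance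 with $2$ agents on a ring with at least $3$ nodes that has a Nash equilibrium $\pi^N$ with $M(\pi^N) = 2$ and an optimal routing $\pi^*$ with $M(\pi^*) = 1$. -/

import Mathlib

open scoped NNReal ENNReal

/-- A selfish ring routing instance. The ring has the nodes `0, …, n - 1` and the links
`0, …, n - 1`, where link `e` joins the nodes `e` and `e + 1` (mod `n`). Link `e` has the latency
function `x ↦ a e * x + b e`, and agent `i` has to be routed from node `s i` to node `t i`. -/
structure SRRInstance where
  /-- the number of nodes, and of links, of the ring -/
  n : ℕ
  /-- the number of agents -/
  k : ℕ
  two_le_n : 2 ≤ n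
  /-- the slopes of the latency functions -/
  a : Fin n → ℝ≥0
  /-- the constant terms of the latency functions -/
  b : Fin n → ℝ≥0
  /-- the sources -/
  s : Fin k → Fin n
  /-- the destinations -/
  t : Fin k → Fin n
  s_ne_t : ∀ i, s i ≠ t i

namespace SRRInstance

/-- The links `u, u + 1, …, v - 1` (mod `n`) passed when walking clockwise from `u` to `v`. -/
def arc {n : ℕ} (u v : Fin n) : Finset (Fin n) :=
  Finset.univ.filter fun e => (e - u).val < (v - u).val

/-- `P` is (the link set of) a path on the ring between the distinct nodes `u` and `v`:
one of the two arcs of the ring with end nodes `u` and `v`. -/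
def IsRingPath {n : ℕ} (u v : Fin n) (P : Finset (Fin n)) : Prop :=
  P = arc u v ∨ P = arc v u

variable (I : SRRInstance)

/-- A family of link sets, one for each agent. -/
abbrev Routing : Type := Fin I.k → Finset (Fin I.n)

/-- In a feasible routing every agent uses a path between its source and its destination. -/
def IsFeasible (π : I.Routing) : Prop :=
  ∀ i, IsRingPath (I.s i) (I.t i) (π i)

/-- The number of agents that use link `e` in `π`. -/
def load (π : I.Routing) (e : Fin I.n) : ℕ :=
  (Finset.univ.filter fun i => e ∈ π i).card

/-- The latency `ℓ(P, π)` of a set `P` of links in the routing `π`. -/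
noncomputable def latency (P : Finset (Fin I.n)) (π : I.Routing) : ℝ≥0 :=
  ∑ e ∈ P, (I.a e * (I.load π e : ℝ≥0) + I.b e)

/-- The social cost `M(π)`: the maximum latency of an agent. -/
noncomputable def maxLatency (π : I.Routing) : ℝ≥0 :=
  Finset.univ.sup fun i => I.latency (π i) π

/-- A Nash equilibrium: a feasible routing in which no agent can reduce its latency by switching
to another path between its source and destination while the others keep their paths. -/
def IsNash (π : I.Routing) : Prop :=
  I.IsFeasible π ∧ ∀ i P, IsRingPath (I.s i) (I.t i) P →
    I.latency (π i) π ≤ I.latency P (Function.update π i P)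

/-- An optimal routing: a feasible routing of minimum social cost. -/
def IsOptimal (π : I.Routing) : Prop :=
  I.IsFeasible π ∧ ∀ ρ, I.IsFeasible ρ → I.maxLatency π ≤ I.maxLatency ρ

/-- The price of anarchy of selfish ring routing: the supremum, over all instances, of the ratio of
the social cost of a Nash equilibrium to the optimal social cost. The ratio is taken in `ℝ≥0∞`, so
that `0 / 0 = 0`, and `c / 0 = ∞` for `c > 0`. -/
noncomputable def priceOfAnarchy : ℝ≥0∞ :=
  ⨆ (I : SRRInstance) (πN : I.Routing) (_ : I.IsNash πN) (πO : I.Routing) (_ : I.IsOptimal πO),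
    (I.maxLatency πN : ℝ≥0∞) / (I.maxLatency πO : ℝ≥0∞)

end SRRInstance

namespace SRRInstance

/-! ### The two paths of an agent -/

/-! Upper bound: compare an equilibrium `π` with any feasible `ρ`. Let `k` agents switch paths
between them, `d` of which use link `e` in `π`. The two paths of an agent are complementary, so
`load ρ e = load π e + k - 2 * d` (`IsFeasible.load_eq`). Adding the equilibrium conditions of agent
`i` and of all switching agents to the bounds by `maxLatency ρ`, with weights `α, c, m, β` and `m +
β = 2`, reduces the claim to one inequality per link (`IsNash.latency_le_of_linkIneq`). That
inequality is affine in the excess load and leaves polynomial conditions on `d` and `k`; suitable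
weights depend on `k` and on whether `i` switches.

Lower bound: in `triangle`, both agents may be stuck on their long paths, at twice the optimal cost.
-/

theorem arc_swap {n : ℕ} {u v : Fin n} (h : u ≠ v) : arc v u = (arc u v)ᶜ := by
  ext e
  simp only [arc, Finset.mem_filter, Finset.mem_univ, true_and, Finset.mem_compl]
  -- The order of `u`, `v`, `e` decides which subtractions wrap around modulo `n`.
  rcases lt_or_gt_of_ne h with h1 | h1 <;> rcases lt_or_ge e u with h2 | h2 <;>
    rcases lt_or_ge e v with h3 | h3 <;>
    simp only [Fin.coe_sub_iff_lt.2, Fin.sub_val_of_le, h1, h2, h3, h1.le] <;>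
    simp only [Fin.le_def, Fin.lt_def] at h1 h2 h3 <;> omega

theorem IsRingPath.compl {n : ℕ} {u v : Fin n} (h : u ≠ v) {P : Finset (Fin n)}
    (hP : IsRingPath u v P) : IsRingPath u v Pᶜ := by
  rcases hP with rfl | rfl
  · exact .inr (arc_swap h).symm
  · exact .inl (arc_swap h.symm).symm

theorem IsRingPath.eq_compl_of_ne {n : ℕ} {u v : Fin n} (h : u ≠ v) {P Q : Finset (Fin n)}
    (hP : IsRingPath u v P) (hQ : IsRingPath u v Q) (hPQ : P ≠ Q) : Q = Pᶜ := by
  rcases hP with rfl | rfl <;> rcases hQ with rfl | rfl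
  · exact absurd rfl hPQ
  · exact arc_swap h
  · exact arc_swap h.symm
  · exact absurd rfl hPQ

variable {I : SRRInstance}

/-! ### Loads and latencies -/

theorem load_update_compl (π : I.Routing) (i : Fin I.k) {e : Fin I.n} (he : e ∉ π i) :
    I.load (Function.update π i (π i)ᶜ) e = I.load π e + 1 := by
  have hset : (Finset.univ.filter fun j => e ∈ Function.update π i (π i)ᶜ j) =
      insert i (Finset.univ.filter fun j => e ∈ π j) := by
    ext j
    rcases eq_or_ne j i with rfl | hj
    · simp [he]
    · simp [hj]
  rw [load, load, hset, Finset.card_insert_of_notMem (by simp [he])]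

theorem coe_load (π : I.Routing) (e : Fin I.n) :
    (I.load π e : ℝ) = ∑ j, if e ∈ π j then (1 : ℝ) else 0 := by
  simp [load]

theorem coe_latency (P : Finset (Fin I.n)) (π : I.Routing) :
    (I.latency P π : ℝ) =
      ∑ e, (if e ∈ P then (1 : ℝ) else 0) * (I.a e * I.load π e + I.b e) := by
  simp [latency, ite_mul, Finset.sum_ite_mem]

theorem latency_le_maxLatency (π : I.Routing) (i : Fin I.k) :
    I.latency (π i) π ≤ I.maxLatency π :=
  Finset.le_sup (f := fun i => I.latency (π i) π) (Finset.mem_univ i)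

/-- Deviation means taking the complement, where every link gains one agent. Indicator sums over all
links allow these conditions to be added over agents. -/
theorem IsNash.sum_le_sum {π : I.Routing} (hπ : I.IsNash π) (i : Fin I.k) :
    ∑ e, (if e ∈ π i then (1 : ℝ) else 0) * (I.a e * I.load π e + I.b e) ≤
      ∑ e, (1 - if e ∈ π i then (1 : ℝ) else 0) * (I.a e * (I.load π e + 1) + I.b e) := by
  have h : (I.latency (π i) π : ℝ) ≤ I.latency (π i)ᶜ (Function.update π i (π i)ᶜ) :=
    NNReal.coe_le_coe.2 (hπ.2 i _ ((hπ.1 i).compl (I.s_ne_t i)))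
  rw [coe_latency, coe_latency] at h
  refine h.trans_eq (Finset.sum_congr rfl fun e _ => ?_)
  by_cases he : e ∈ π i
  · simp [he]
  · simp [he, load_update_compl π i he]

/-! ### The agents that use different paths in two routings -/

/-- The agents whose paths in `π` and `ρ` differ. -/
def switching (π ρ : I.Routing) : Finset (Fin I.k) :=
  Finset.univ.filter fun j => π j ≠ ρ j

/-- The number of switching agents that use link `e` in `π`. -/
def switchingLoad (π ρ : I.Routing) (e : Fin I.n) : ℕ :=
  ((switching π ρ).filter fun j => e ∈ π j).card

theorem coe_switchingLoad (π ρ : I.Routing) (e : Fin I.n) :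
    (switchingLoad π ρ e : ℝ) = ∑ j ∈ switching π ρ, if e ∈ π j then (1 : ℝ) else 0 := by
  simp [switchingLoad]

theorem IsFeasible.indicator_of_mem_switching {π ρ : I.Routing} (hπ : I.IsFeasible π)
    (hρ : I.IsFeasible ρ) {j : Fin I.k} (hj : j ∈ switching π ρ) (e : Fin I.n) :
    (if e ∈ ρ j then (1 : ℝ) else 0) = 1 - if e ∈ π j then (1 : ℝ) else 0 := by
  rw [(hπ j).eq_compl_of_ne (I.s_ne_t j) (hρ j) (Finset.mem_filter.1 hj).2]
  by_cases he : e ∈ π j <;> simp [he]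

/-- Passing to `ρ`, the `d` switching agents on `e` leave it and the other `k - d` enter it. -/
theorem IsFeasible.load_eq {π ρ : I.Routing} (hπ : I.IsFeasible π) (hρ : I.IsFeasible ρ)
    (e : Fin I.n) :
    (I.load ρ e : ℝ) = I.load π e + (switching π ρ).card - 2 * switchingLoad π ρ e := by
  have hind : ∀ j, (if e ∈ ρ j then (1 : ℝ) else 0) = (if e ∈ π j then (1 : ℝ) else 0) +
      if j ∈ switching π ρ then 1 - 2 * (if e ∈ π j then (1 : ℝ) else 0) else 0 := by
    intro j
    by_cases hj : j ∈ switching π ρ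
    · rw [hπ.indicator_of_mem_switching hρ hj, if_pos hj]
      ring
    · have : π j = ρ j := by simpa [switching] using hj
      rw [if_neg hj, this, add_zero]
  rw [coe_load, Finset.sum_congr rfl fun j _ => hind j, Finset.sum_add_distrib, ← coe_load,
    Finset.sum_ite_mem, Finset.univ_inter, Finset.sum_sub_distrib, ← Finset.mul_sum,
    ← coe_switchingLoad]
  simp
  ring

theorem switchingLoad_le_card (π ρ : I.Routing) (e : Fin I.n) :
    switchingLoad π ρ e ≤ (switching π ρ).card :=
  Finset.card_filter_le _ _

theorem switchingLoad_le_load (π ρ : I.Routing) (e : Fin I.n) :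
    switchingLoad π ρ e ≤ I.load π e :=
  Finset.card_le_card (Finset.filter_subset_filter _ (Finset.subset_univ _))

theorem switchingLoad_lt_load {π ρ : I.Routing} {e : Fin I.n} {i : Fin I.k}
    (hi : i ∉ switching π ρ) (he : e ∈ π i) : switchingLoad π ρ e < I.load π e := by
  refine Finset.card_lt_card ⟨Finset.filter_subset_filter _ (Finset.subset_univ _), fun h => hi ?_⟩
  exact (Finset.mem_filter.1 (h (by simp [he]))).1

theorem switchingLoad_pos {π ρ : I.Routing} {e : Fin I.n} {i : Fin I.k}
    (hi : i ∈ switching π ρ) (he : e ∈ π i) : 0 < switchingLoad π ρ e :=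
  Finset.card_pos.2 ⟨i, by simp [hi, he]⟩

theorem switchingLoad_lt_card {π ρ : I.Routing} {e : Fin I.n} {i : Fin I.k}
    (hi : i ∈ switching π ρ) (he : e ∉ π i) : switchingLoad π ρ e < (switching π ρ).card := by
  refine Finset.card_lt_card ⟨Finset.filter_subset _ _, fun h => he ?_⟩
  exact (Finset.mem_filter.1 (h hi)).2

/-! ### Weighted sums of the equilibrium and optimality inequalities -/

/-- The inequality at a single link `e` that remains to be checked when the equilibrium conditions
of agent `i` and of the switching agents are added up with the weights `α` and `c`, and the bounds
on the latencies in `ρ` of the switching agents and of agent `i` with the weights `m` and `β`. -/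
def LinkIneq (π ρ : I.Routing) (i : Fin I.k) (α c m β : ℝ) (e : Fin I.n) : Prop :=
  let k : ℝ := (switching π ρ).card
  let d : ℝ := switchingLoad π ρ e
  let p : ℝ := if e ∈ π i then 1 else 0
  let x : ℝ := I.a e * I.load π e + I.b e
  let x' : ℝ := I.a e * (I.load π e + 1) + I.b e
  let y : ℝ := I.a e * I.load ρ e + I.b e
  k * (p * x) ≤ α * k * (p * x - (1 - p) * x') + c * (d * x - (k - d) * x') + m * ((k - d) * y) +
    β * k * ((if e ∈ ρ i then 1 else 0) * y)

theorem IsNash.latency_le_of_linkIneq {π ρ : I.Routing} (hπ : I.IsNash π) (hρ : I.IsFeasible ρ)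
    (i : Fin I.k) (hk : 0 < (switching π ρ).card) {α c m β : ℝ} (hα : 0 ≤ α) (hc : 0 ≤ c)
    (hm : 0 ≤ m) (hβ : 0 ≤ β) (hmβ : m + β = 2) (h : ∀ e, LinkIneq π ρ i α c m β e) :
    (I.latency (π i) π : ℝ) ≤ 2 * I.maxLatency ρ := by
  have hk' : (0 : ℝ) < (switching π ρ).card := by exact_mod_cast hk
  have hρle : ∀ j, ∑ e, (if e ∈ ρ j then (1 : ℝ) else 0) * (I.a e * I.load ρ e + I.b e) ≤
      I.maxLatency ρ := fun j => by
    rw [← coe_latency]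
    exact NNReal.coe_le_coe.2 (latency_le_maxLatency ρ j)
  have hsum := Finset.sum_le_sum fun e (_ : e ∈ Finset.univ) => h e
  simp only [Finset.sum_add_distrib, ← Finset.mul_sum, Finset.sum_sub_distrib] at hsum
  rw [← coe_latency] at hsum
  have hnash := hπ.sum_le_sum i
  rw [← coe_latency] at hnash
  -- After exchanging the sums, link `e` is counted `d` times on the left and `k - d` times on the
  -- right.
  have hnashSum : ∑ e, (switchingLoad π ρ e : ℝ) * (I.a e * I.load π e + I.b e) ≤
      ∑ e, (((switching π ρ).card : ℝ) - switchingLoad π ρ e) *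
        (I.a e * (I.load π e + 1) + I.b e) := by
    have := Finset.sum_le_sum fun j (_ : j ∈ switching π ρ) => hπ.sum_le_sum j
    rw [Finset.sum_comm, Finset.sum_comm (s := switching π ρ)] at this
    simpa only [← Finset.sum_mul, Finset.sum_sub_distrib, ← coe_switchingLoad, Finset.sum_const,
      nsmul_eq_mul, mul_one] using this
  have hoptSum : ∑ e, (((switching π ρ).card : ℝ) - switchingLoad π ρ e) *
      (I.a e * I.load ρ e + I.b e) ≤ (switching π ρ).card * I.maxLatency ρ := by
    have := Finset.sum_le_sum fun j (_ : j ∈ switching π ρ) => hρle j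
    rw [Finset.sum_congr rfl fun j hj => Finset.sum_congr rfl fun e _ => by
      rw [hπ.1.indicator_of_mem_switching hρ hj e], Finset.sum_comm] at this
    simpa only [← Finset.sum_mul, Finset.sum_sub_distrib, ← coe_switchingLoad, Finset.sum_const,
      nsmul_eq_mul, mul_one] using this
  have h1 := mul_le_mul_of_nonneg_left hnash (mul_nonneg hα hk'.le)
  have h2 := mul_le_mul_of_nonneg_left hnashSum hc
  have h3 := mul_le_mul_of_nonneg_left hoptSum hm
  have h4 := mul_le_mul_of_nonneg_left (hρle i) (mul_nonneg hβ hk'.le)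
  refine le_of_mul_le_mul_left ?_ hk'
  obtain rfl : β = 2 - m := by linarith
  nlinarith

/-- The link inequality for an agent outside the switching set follows from the nonnegativity of
four polynomials. -/
theorem IsFeasible.linkIneq_of_notMem {π ρ : I.Routing} (hπ : I.IsFeasible π)
    (hρ : I.IsFeasible ρ) {i : Fin I.k} (hi : i ∉ switching π ρ) {α c m β : ℝ}
    (h : ∀ d : ℕ, d ≤ (switching π ρ).card → ∀ k : ℝ, k = (switching π ρ).card →
      0 ≤ (α + β - 1) * k + c * (2 * d - k) + m * (k - d) ∧
      0 ≤ -α * k + c * (2 * d - k) + m * (k - d) ∧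
      0 ≤ (α - 1) * k * (d + 1) + c * (d * (d + 1) - (k - d) * (d + 2)) +
        m * (k - d) * (k - d + 1) + β * k * (k - d + 1) ∧
      0 ≤ -α * k * (d + 1) + c * (d * d - (k - d) * (d + 1)) + m * (k - d) ^ 2) (e : Fin I.n) :
    LinkIneq π ρ i α c m β e := by
  obtain ⟨h1, h2, h3, h4⟩ := h _ (switchingLoad_le_card π ρ e) _ rfl
  have hpath : π i = ρ i := by simpa [switching] using hi
  have ha : (0 : ℝ) ≤ I.a e := (I.a e).2
  have hb : (0 : ℝ) ≤ I.b e := (I.b e).2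
  rw [LinkIneq, hπ.load_eq hρ, ← hpath]
  by_cases he : e ∈ π i
  -- Agent `i` uses `e` without switching, hence the extra 1. With `z = a * (load - d - 1) + b ≥ 0`,
  -- the difference of the two sides is `z` times the first polynomial plus `a` times the third.
  · have hd : (switchingLoad π ρ e : ℝ) + 1 ≤ I.load π e := by
      exact_mod_cast switchingLoad_lt_load hi he
    have hz := add_nonneg (mul_nonneg ha (sub_nonneg.2 hd)) hb
    simp only [he, if_true]
    linear_combination mul_nonneg hz h1 + mul_nonneg ha h3
  · have hd : (switchingLoad π ρ e : ℝ) ≤ I.load π e := by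
      exact_mod_cast switchingLoad_le_load π ρ e
    have hz := add_nonneg (mul_nonneg ha (sub_nonneg.2 hd)) hb
    simp only [he, if_false]
    linear_combination mul_nonneg hz h2 + mul_nonneg ha h4

/-- The link inequality for a switching agent follows from the nonnegativity of four
polynomials. -/
theorem IsFeasible.linkIneq_of_mem {π ρ : I.Routing} (hπ : I.IsFeasible π)
    (hρ : I.IsFeasible ρ) {i : Fin I.k} (hi : i ∈ switching π ρ) {α c m β : ℝ}
    (h : ∀ d : ℕ, d ≤ (switching π ρ).card → ∀ k : ℝ, k = (switching π ρ).card →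
      (0 < d → 0 ≤ (α - 1) * k + c * (2 * d - k) + m * (k - d) ∧
        0 ≤ (α - 1) * k * d + c * (d * d - (k - d) * (d + 1)) + m * (k - d) ^ 2) ∧
      (d < (switching π ρ).card → 0 ≤ (β - α) * k + c * (2 * d - k) + m * (k - d) ∧
        0 ≤ -α * k * (d + 1) + c * (d * d - (k - d) * (d + 1)) + m * (k - d) ^ 2 +
          β * k * (k - d))) (e : Fin I.n) :
    LinkIneq π ρ i α c m β e := by
  obtain ⟨h1, h2⟩ := h _ (switchingLoad_le_card π ρ e) _ rfl
  have ha : (0 : ℝ) ≤ I.a e := (I.a e).2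
  have hb : (0 : ℝ) ≤ I.b e := (I.b e).2
  have hd : (switchingLoad π ρ e : ℝ) ≤ I.load π e := by
    exact_mod_cast switchingLoad_le_load π ρ e
  have hz := add_nonneg (mul_nonneg ha (sub_nonneg.2 hd)) hb
  rw [LinkIneq, hπ.load_eq hρ, hπ.indicator_of_mem_switching hρ hi]
  by_cases he : e ∈ π i
  · obtain ⟨hl, hq⟩ := h1 (switchingLoad_pos hi he)
    simp only [he, if_true]
    linear_combination mul_nonneg hz hl + mul_nonneg ha hq
  · obtain ⟨hl, hq⟩ := h2 (switchingLoad_lt_card hi he)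
    simp only [he, if_false]
    linear_combination mul_nonneg hz hl + mul_nonneg ha hq

/-! ### The upper bound -/

/-- Integrality matters: for `k = 3` the quadratic is negative at some real `d`. Small `k` are
therefore checked pointwise. -/
theorem quadratic_nonneg_of_three_le {k d : ℕ} (hk : 3 ≤ k) (h : d ≤ k) :
    (0 : ℝ) ≤ -(1 / 3) * k * (d + 1) + 4 / 3 * (d * d - (k - d) * (d + 1)) +
      5 / 3 * (k - d) ^ 2 := by
  rcases le_or_gt k 7 with hk' | hk'
  · interval_cases k <;> interval_cases d <;> norm_num
  have : (8 : ℝ) ≤ k := by exact_mod_cast hk'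
  have h' : (d : ℝ) ≤ k := by exact_mod_cast h
  -- The square is centred at the real minimizer in `d`; likewise in the next two lemmas.
  nlinarith [sq_nonneg ((d : ℝ) - 15 / 26 * k + 2 / 13)]

theorem quadratic_nonneg_of_four_le {k d : ℕ} (hk : 4 ≤ k) (h : d ≤ k) :
    (0 : ℝ) ≤ (1 / 2 - 1) * k * d + 5 / 4 * (d * d - (k - d) * (d + 1)) +
      7 / 4 * (k - d) ^ 2 := by
  rcases le_or_gt k 7 with hk' | hk'
  · interval_cases k <;> interval_cases d <;> norm_num
  have : (8 : ℝ) ≤ k := by exact_mod_cast hk'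
  have h' : (d : ℝ) ≤ k := by exact_mod_cast h
  nlinarith [sq_nonneg ((d : ℝ) - 21 / 34 * k + 5 / 34)]

theorem quadratic_nonneg_of_lt {k d : ℕ} (hk : 4 ≤ k) (h : d < k) :
    (0 : ℝ) ≤ -(1 / 2) * k * (d + 1) + 5 / 4 * (d * d - (k - d) * (d + 1)) +
      7 / 4 * (k - d) ^ 2 + 1 / 4 * k * (k - d) := by
  rcases le_or_gt k 7 with hk' | hk'
  · interval_cases k <;> interval_cases d <;> norm_num
  have : (8 : ℝ) ≤ k := by exact_mod_cast hk'
  have h' : (d : ℝ) + 1 ≤ k := by exact_mod_cast h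
  nlinarith [sq_nonneg ((d : ℝ) - 11 / 17 * k + 5 / 34)]

theorem IsNash.latency_le_of_notMem {π ρ : I.Routing} (hπ : I.IsNash π) (hρ : I.IsFeasible ρ)
    (i : Fin I.k) (hk : 0 < (switching π ρ).card) (hi : i ∉ switching π ρ) :
    (I.latency (π i) π : ℝ) ≤ 2 * I.maxLatency ρ := by
  rcases lt_or_ge (switching π ρ).card 3 with h3 | h3
  · refine hπ.latency_le_of_linkIneq hρ i hk (α := 0) (c := 1) (m := 1) (β := 1) (by norm_num)
      (by norm_num) (by norm_num) (by norm_num) (by norm_num)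
      (hπ.1.linkIneq_of_notMem hρ hi ?_)
    rintro d hd _ rfl
    generalize (switching π ρ).card = k at *
    interval_cases k <;> interval_cases d <;> norm_num
  · refine hπ.latency_le_of_linkIneq hρ i hk (α := 1 / 3) (c := 4 / 3) (m := 5 / 3) (β := 1 / 3)
      (by norm_num) (by norm_num) (by norm_num) (by norm_num) (by norm_num)
      (hπ.1.linkIneq_of_notMem hρ hi ?_)
    rintro d hd _ rfl
    generalize (switching π ρ).card = k at *
    have hk3 : (3 : ℝ) ≤ k := by exact_mod_cast h3
    have hdk : (d : ℝ) ≤ k := by exact_mod_cast hd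
    have hd0 : (0 : ℝ) ≤ d := d.cast_nonneg
    refine ⟨by linarith, by linarith, ?_, quadratic_nonneg_of_three_le h3 hd⟩
    nlinarith [sq_nonneg ((d : ℝ) - 5 / 8 * k), sq_nonneg ((d : ℝ) - 5 / 8 * k + 1 / 2)]

theorem IsNash.latency_le_of_mem {π ρ : I.Routing} (hπ : I.IsNash π) (hρ : I.IsFeasible ρ)
    (i : Fin I.k) (hk : 0 < (switching π ρ).card) (hi : i ∈ switching π ρ) :
    (I.latency (π i) π : ℝ) ≤ 2 * I.maxLatency ρ := by
  rcases lt_or_ge (switching π ρ).card 3 with h3 | h3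
  -- For `k ≤ 2` the conditions of `i` alone suffice: on each link of its other path, the deviation
  -- cost is at most twice the cost in `ρ`.
  · refine hπ.latency_le_of_linkIneq hρ i hk (α := 1) (c := 0) (m := 0) (β := 2) (by norm_num)
      (by norm_num) (by norm_num) (by norm_num) (by norm_num) (hπ.1.linkIneq_of_mem hρ hi ?_)
    rintro d hd _ rfl
    generalize (switching π ρ).card = k at *
    interval_cases k <;> interval_cases d <;> norm_num
  rcases h3.eq_or_lt with h3 | h4
  -- These weights need `0 < d` on the links of `i`: the linear form there vanishes at `d = 1` and
  -- is negative at `d = 0`.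
  · refine hπ.latency_le_of_linkIneq hρ i hk (α := 1 / 2) (c := 3 / 2) (m := 3 / 2) (β := 1 / 2)
      (by norm_num) (by norm_num) (by norm_num) (by norm_num) (by norm_num)
      (hπ.1.linkIneq_of_mem hρ hi ?_)
    rintro d hd _ rfl
    rw [← h3] at hd ⊢
    interval_cases d <;> norm_num
  · refine hπ.latency_le_of_linkIneq hρ i hk (α := 1 / 2) (c := 5 / 4) (m := 7 / 4) (β := 1 / 4)
      (by norm_num) (by norm_num) (by norm_num) (by norm_num) (by norm_num)
      (hπ.1.linkIneq_of_mem hρ hi ?_)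
    rintro d hd _ rfl
    generalize (switching π ρ).card = k at *
    have hk4 : (4 : ℝ) ≤ k := by exact_mod_cast h4
    have hdk : (d : ℝ) ≤ k := by exact_mod_cast hd
    have hd0 : (0 : ℝ) ≤ d := d.cast_nonneg
    exact ⟨fun _ => ⟨by linarith, quadratic_nonneg_of_four_le h4 hd⟩,
      fun hlt => ⟨by linarith, quadratic_nonneg_of_lt h4 hlt⟩⟩

theorem IsNash.maxLatency_le {π ρ : I.Routing} (hπ : I.IsNash π) (hρ : I.IsFeasible ρ) :
    I.maxLatency π ≤ 2 * I.maxLatency ρ := by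
  refine Finset.sup_le fun i _ => ?_
  rcases (switching π ρ).eq_empty_or_nonempty with h0 | h0
  · obtain rfl : π = ρ := by
      funext j
      by_contra hj
      exact Finset.notMem_empty j (h0 ▸ Finset.mem_filter.2 ⟨Finset.mem_univ j, hj⟩)
    exact (latency_le_maxLatency π i).trans (le_mul_of_one_le_left zero_le one_le_two)
  have hk := Finset.card_pos.2 h0
  rw [← NNReal.coe_le_coe, NNReal.coe_mul, NNReal.coe_ofNat]
  by_cases hi : i ∈ switching π ρ
  · exact hπ.latency_le_of_mem hρ i hk hi
  · exact hπ.latency_le_of_notMem hρ i hk hi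

theorem priceOfAnarchy_le_two : priceOfAnarchy ≤ 2 := by
  refine iSup_le fun I => iSup_le fun πN => iSup_le fun hN => iSup_le fun πO => iSup_le fun hO => ?_
  refine ENNReal.div_le_of_le_mul ?_
  exact_mod_cast hN.maxLatency_le hO.1

/-! ### The lower bound -/

/-- The ring with three nodes, the slopes `1, 1, 1 / 2`, and two agents that have to be routed
from node `0` to node `1` and from node `1` to node `2`. -/
noncomputable def triangle : SRRInstance where
  n := 3
  k := 2
  two_le_n := by norm_num
  a := ![1, 1, 1 / 2]
  b := 0
  s := ![0, 1]
  t := ![1, 2]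
  s_ne_t := by decide

theorem slope_le_latency (π : I.Routing) (i : Fin I.k) {e : Fin I.n} (he : e ∈ π i) :
    I.a e ≤ I.latency (π i) π := by
  have hload : (1 : ℝ≥0) ≤ I.load π e := by
    exact_mod_cast Finset.card_pos.2 ⟨i, Finset.mem_filter.2 ⟨Finset.mem_univ i, he⟩⟩
  calc I.a e ≤ I.a e * I.load π e + I.b e :=
        (le_mul_of_one_le_right zero_le hload).trans le_self_add
    _ ≤ I.latency (π i) π :=
        Finset.single_le_sum (f := fun e => I.a e * (I.load π e : ℝ≥0) + I.b e)
          (fun _ _ => zero_le) he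

namespace triangle

/-- The routing of `triangle` with the link sets `P` and `Q`. -/
def routing (P Q : Finset (Fin 3)) : triangle.Routing := ![P, Q]

theorem isRingPath_zero (P : Finset (Fin 3)) :
    IsRingPath (0 : Fin 3) 1 P ↔ P = {0} ∨ P = {1, 2} := by
  rw [IsRingPath, show arc (0 : Fin 3) 1 = {0} by decide,
    show arc (1 : Fin 3) 0 = {1, 2} by decide]

theorem isRingPath_one (P : Finset (Fin 3)) :
    IsRingPath (1 : Fin 3) 2 P ↔ P = {1} ∨ P = {0, 2} := by
  rw [IsRingPath, show arc (1 : Fin 3) 2 = {1} by decide,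
    show arc (2 : Fin 3) 1 = {0, 2} by decide]

theorem isFeasible_routing {P Q : Finset (Fin 3)} (hP : P = {0} ∨ P = {1, 2})
    (hQ : Q = {1} ∨ Q = {0, 2}) : triangle.IsFeasible (routing P Q) :=
  Fin.forall_fin_two.2 ⟨(isRingPath_zero P).2 hP, (isRingPath_one Q).2 hQ⟩

theorem load_routing (P Q : Finset (Fin 3)) (e : Fin 3) :
    (triangle.load (routing P Q) e : ℝ≥0) =
      (if e ∈ P then 1 else 0) + if e ∈ Q then 1 else 0 := by
  have h : (triangle.load (routing P Q) e : ℝ≥0) =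
      ∑ j : Fin 2, if e ∈ (![P, Q] : Fin 2 → Finset (Fin 3)) j then (1 : ℝ≥0) else 0 := by
    rw [Finset.sum_boole]
    rfl
  rw [h, Fin.sum_univ_two]
  rfl

theorem latency_routing (S P Q : Finset (Fin 3)) :
    triangle.latency S (routing P Q) = ∑ e ∈ S, (![1, 1, 1 / 2] : Fin 3 → ℝ≥0) e *
      ((if e ∈ P then 1 else 0) + if e ∈ Q then 1 else 0) :=
  Finset.sum_congr rfl fun e _ => (add_zero _).trans (congrArg _ (load_routing P Q e))

theorem maxLatency_routing (P Q : Finset (Fin 3)) :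
    triangle.maxLatency (routing P Q) =
      max (triangle.latency P (routing P Q)) (triangle.latency Q (routing P Q)) := by
  refine eq_of_forall_ge_iff fun c => ?_
  rw [maxLatency, Finset.sup_le_iff, max_le_iff]
  exact ⟨fun h => ⟨h (0 : Fin 2) (Finset.mem_univ _), h (1 : Fin 2) (Finset.mem_univ _)⟩,
    fun h => fun i _ => (Fin.forall_fin_two (p := fun i =>
      triangle.latency (routing P Q i) (routing P Q) ≤ c)).2 h i⟩

theorem update_routing_zero (P Q S : Finset (Fin 3)) :
    Function.update (routing P Q) (0 : Fin 2) S = routing S Q :=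
  funext (Fin.forall_fin_two.2 ⟨rfl, rfl⟩)

theorem update_routing_one (P Q S : Finset (Fin 3)) :
    Function.update (routing P Q) (1 : Fin 2) S = routing P S :=
  funext (Fin.forall_fin_two.2 ⟨rfl, rfl⟩)

/-- Each agent pays `1 + 2 * (1 / 2) = 2`; its direct link, then shared with the other agent, would
also cost 2. -/
theorem isNash_routing : triangle.IsNash (routing {1, 2} {0, 2}) := by
  refine ⟨isFeasible_routing (.inr rfl) (.inr rfl), Fin.forall_fin_two.2
    ⟨fun P hP => le_of_le_of_eq (b := triangle.latency P (routing P {0, 2})) ?_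
      (congrArg _ (update_routing_zero _ _ _).symm),
    fun P hP => le_of_le_of_eq (b := triangle.latency P (routing {1, 2} P)) ?_
      (congrArg _ (update_routing_one _ _ _).symm)⟩⟩
  · refine (latency_routing {1, 2} _ _).trans_le ?_
    rcases (isRingPath_zero P).1 hP with rfl | rfl <;> rw [latency_routing] <;> simp
    norm_num
  · refine (latency_routing {0, 2} _ _).trans_le ?_
    rcases (isRingPath_one P).1 hP with rfl | rfl <;> rw [latency_routing] <;> simp
    norm_num

theorem maxLatency_nash : triangle.maxLatency (routing {1, 2} {0, 2}) = 2 := by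
  rw [maxLatency_routing, latency_routing, latency_routing]
  simp
  norm_num

theorem maxLatency_optimal : triangle.maxLatency (routing {0} {1}) = 1 := by
  rw [maxLatency_routing, latency_routing, latency_routing]
  simp

theorem isOptimal_routing : triangle.IsOptimal (routing {0} {1}) := by
  refine ⟨isFeasible_routing (.inl rfl) (.inl rfl), fun ρ hρ => ?_⟩
  rw [maxLatency_optimal]
  -- Either path of agent 0 contains a link of slope 1, so this agent alone forces cost at least 1.
  refine le_trans ?_ (latency_le_maxLatency ρ (0 : Fin 2))
  rcases (isRingPath_zero (ρ (0 : Fin 2))).1 (hρ (0 : Fin 2)) with h | h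
  · exact slope_le_latency (I := triangle) ρ (0 : Fin 2) (e := (0 : Fin 3))
      (h ▸ Finset.mem_singleton_self _)
  · exact slope_le_latency (I := triangle) ρ (0 : Fin 2) (e := (1 : Fin 3))
      (h ▸ Finset.mem_insert_self _ _)

end triangle

theorem two_le_priceOfAnarchy : 2 ≤ priceOfAnarchy := by
  refine le_iSup_of_le triangle <| le_iSup_of_le _ <| le_iSup_of_le triangle.isNash_routing <|
    le_iSup_of_le _ <| le_iSup_of_le triangle.isOptimal_routing ?_
  rw [triangle.maxLatency_nash, triangle.maxLatency_optimal]
  simp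

end SRRInstance

theorem theorem1 :
    SRRInstance.priceOfAnarchy = 2 ∧
    ∃ (I : SRRInstance) (πN πO : I.Routing), 3 ≤ I.n ∧ I.k = 2 ∧
      I.IsNash πN ∧ I.IsOptimal πO ∧ I.maxLatency πN = 2 ∧ I.maxLatency πO = 1 := by
  open SRRInstance in
  exact ⟨le_antisymm priceOfAnarchy_le_two two_le_priceOfAnarchy,
    triangle, _, _, le_rfl, rfl, triangle.isNash_routing, triangle.isOptimal_routing,
    triangle.maxLatency_nash, triangle.maxLatency_optimal⟩
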